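/- For $\theta\in\mathbb{R}$ let $R_x^\theta, R_y^\theta\in SO(3)$ denote the rotations of $\mathbb{R}^3$ by the angle $\theta$ about the $x$-axis and the $y$-axis, respectively, and for positive integers $p,q$ let $\hat G(p,q)\subset SO(3)$ be the subgroup generated by $R_x^{2\pi/p}$ and $R_y^{2\pi/q}$. Let $m$ be any positive integer other than $1,2,4,8$, let $S=R_y^{\pi/2}$ and $T=R_x^{2\pi/m}$, and put $A=STST$ and $B=ST^2ST^2$. Then the rotations $A$ and $B$ are independent, i.e. the homomorphism from the free group on two generators to $SO(3)$ that sends the generators to $A$ and $B$ is injective; and the subgroup of $SO(3)$ generated by $A$ and $B$ is free of rank $2$ with basis $A, B$, and is contained in $\hat G(m,4)$. -/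

import Mathlib

open Real

noncomputable section

/-- The group `SO(3)` of rotations of three-dimensional Euclidean space, as real `3 × 3` orthogonal
matrices of determinant `1`, acting on column vectors. -/
abbrev SO3 : Type := Matrix.specialOrthogonalGroup (Fin 3) ℝ

/-- The (right-handed) rotation by the angle `θ` about the `x`-axis. -/
def rotX (θ : ℝ) : SO3 :=
  ⟨!![1, 0, 0; 0, cos θ, -sin θ; 0, sin θ, cos θ], by
    rw [Matrix.mem_specialOrthogonalGroup_iff, Matrix.mem_orthogonalGroup_iff]
    have h := sin_sq_add_cos_sq θ
    constructor
    · ext i j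
      fin_cases i <;> fin_cases j <;>
        simp [Matrix.mul_apply, Fin.sum_univ_three] <;> linarith
    · simp [Matrix.det_fin_three]; linarith⟩

/-- The (right-handed) rotation by the angle `θ` about the `y`-axis. -/
def rotY (θ : ℝ) : SO3 :=
  ⟨!![cos θ, 0, sin θ; 0, 1, 0; -sin θ, 0, cos θ], by
    rw [Matrix.mem_specialOrthogonalGroup_iff, Matrix.mem_orthogonalGroup_iff]
    have h := sin_sq_add_cos_sq θ
    constructor
    · ext i j
      fin_cases i <;> fin_cases j <;>
        simp [Matrix.mul_apply, Fin.sum_univ_three] <;> linarith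
    · simp [Matrix.det_fin_three]; linarith⟩

/-- The group `Ĝ(p, q)`: the subgroup of `SO(3)` generated by the rotation by `2π/p` about the
`x`-axis and the rotation by `2π/q` about the `y`-axis. -/
def hatG (p q : ℕ) : Subgroup SO3 :=
  Subgroup.closure {rotX (2 * π / p), rotY (2 * π / q)}

end

/-! Fix a valuation on `ℂ` with `v 2 < 1`. For `θ = 2π/m` both `cos θ` and `cos (2θ)` have valuation
greater than `1`, because a root of unity congruent to `1` modulo `2` is `±1`
(`one_lt_valuation_cos`). Hence `T^{±1}` and `T^{±2}` strictly enlarge the dominant second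
coordinate of a vector, while `S^{±1}` only exchanges the first and third coordinates up to sign.
Reduced words in `A`, `B` remain alternating in `S^{±1}` and `T^{±1}, T^{±2}` after cancellation, so
ping-pong on the second column (`injective_lift_of_alternating`) shows that none is trivial. -/

/-! ### Roots of unity under a valuation of residue characteristic two -/

section Valuation

variable {Γ₀ : Type*} [LinearOrderedCommGroupWithZero Γ₀]

/-- The complex numbers carry a valuation extending (up to equivalence) the `2`-adic one. -/
theorem exists_valuationSubring_valuation_two_lt_one :
    ∃ V : ValuationSubring ℂ, V.valuation 2 < 1 := by
  let R : Subring ℂ := (Int.castRingHom ℂ).range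
  have hI : Ideal.span {(2 : R)} ≠ ⊤ := by
    rw [Ne, Ideal.span_singleton_eq_top, isUnit_iff_exists_inv]
    rintro ⟨⟨_, k, rfl⟩, hk⟩
    have h : (2 : ℂ) * (k : ℂ) = 1 := congrArg Subtype.val hk
    have h' : 2 * k = 1 := by exact_mod_cast h
    omega
  obtain ⟨V, -, hV⟩ := Ideal.image_subset_nonunits_valuationSubring _ hI
  exact ⟨V, V.mem_nonunits_iff.1 (hV ⟨2, Ideal.subset_span rfl, rfl⟩)⟩

theorem Valuation.map_natCast_le_one {R : Type*} [Ring R] (v : Valuation R Γ₀) (n : ℕ) :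
    v n ≤ 1 := by
  induction n with
  | zero => simp
  | succ n ih => rw [Nat.cast_succ]; exact v.map_add_le ih v.map_one.le

theorem Valuation.map_eq_one_of_pow_eq_one {R : Type*} [Ring R] (v : Valuation R Γ₀) {x : R}
    {n : ℕ} (hn : n ≠ 0) (hx : x ^ n = 1) : v x = 1 := by
  rw [← pow_left_inj₀ zero_le zero_le hn, ← map_pow, hx, map_one, one_pow]

/-- A root of unity that is congruent to `1` modulo `2` is `1` or `-1`. -/
theorem eq_one_or_eq_neg_one_of_valuation_sub_one_le {K : Type*} [Field K] [NeZero (2 : K)]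
    (v : Valuation K Γ₀) (h2 : v 2 < 1) {n : ℕ} (hn : n ≠ 0) {x : K} (hx : x ^ n = 1)
    (hv : v (x - 1) ≤ v 2) : x = 1 ∨ x = -1 := by
  induction n using Nat.strong_induction_on generalizing x with
  | _ n ih =>
    have hx1 : v x = 1 := v.map_eq_one_of_pow_eq_one hn hx
    obtain ⟨k, rfl | rfl⟩ := Nat.even_or_odd' n
    · have hsq : x ^ 2 = 1 ∨ x ^ 2 = -1 := by
        refine ih k (by omega) (by omega) (by rw [← pow_mul, hx]) ?_
        have h1 : x ^ 2 - 1 = (x - 1) * (x + 1) := by ring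
        rw [h1, map_mul]
        exact (mul_le_of_le_one_right' (v.map_add_le hx1.le v.map_one.le)).trans hv
      refine hsq.elim (by simp) fun h ↦ ?_
      -- If `x² = -1`, then `(x - 1)² = -2x` has valuation exactly `v 2`, but the congruence forces
      -- at most `v 2 ^ 2`.
      have hsq' : v (x - 1) ^ 2 = v 2 := by
        rw [← map_pow, show (x - 1) ^ 2 = -(2 * x) by linear_combination h, v.map_neg, map_mul,
          hx1, mul_one]
      have hv2 : 0 < v 2 := v.pos_iff.2 two_ne_zero
      have hlt : v (x - 1) ^ 2 < v 2 := calc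
        v (x - 1) ^ 2 ≤ v 2 ^ 2 := by gcongr
        _ < v 2 := by rw [sq]; exact mul_lt_of_lt_one_left hv2 h2
      exact absurd hsq' hlt.ne
    · left
      by_contra hne
      have hsum : ∑ i ∈ Finset.range (2 * k + 1), x ^ i = 0 := by
        have := geom_sum_mul x (2 * k + 1)
        rw [hx, sub_self] at this
        exact (mul_eq_zero.1 this).resolve_right (sub_ne_zero.2 hne)
      -- Each power of `x` is congruent to `1`, so the vanishing geometric sum would make the odd
      -- number `2k + 1` a non-unit.
      have hlt : v (∑ i ∈ Finset.range (2 * k + 1), (1 - x ^ i)) < 1 := by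
        refine v.map_sum_lt one_ne_zero fun i _ ↦ ?_
        rw [v.map_sub_swap, ← geom_sum_mul, map_mul]
        refine (mul_le_of_le_one_left' (v.map_sum_le fun j _ ↦ ?_)).trans_lt (hv.trans_lt h2)
        rw [map_pow, hx1, one_pow]
      rw [Finset.sum_sub_distrib, hsum, sub_zero, Finset.sum_const, Finset.card_range,
        nsmul_one] at hlt
      have hodd : v ((2 * k + 1 : ℕ) : K) = 1 := by
        push_cast
        rw [v.map_add_eq_of_lt_right, map_one]
        rw [map_one, map_mul]
        exact (mul_le_of_le_one_right' (v.map_natCast_le_one k)).trans_lt h2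
      exact hlt.ne hodd

/-- With `z = exp(iθ)`, `2 z cos θ = z² + 1`: an integral cosine would make `-z²` congruent to `1`
modulo `2`, hence `±1`, and then `cos θ` or `sin θ` vanishes. -/
theorem one_lt_valuation_cos (v : Valuation ℂ Γ₀) (h2 : v 2 < 1) {n : ℕ} (hn : n ≠ 0) {θ : ℝ}
    (hθ : Complex.exp (θ * Complex.I) ^ n = 1) (hs : sin θ ≠ 0) (hc : cos θ ≠ 0) :
    1 < v (cos θ : ℝ) := by
  set z := Complex.exp (θ * Complex.I) with hz
  have hz0 : z ≠ 0 := Complex.exp_ne_zero _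
  have hzi : Complex.exp (-θ * Complex.I) = z⁻¹ := by rw [neg_mul, Complex.exp_neg]
  have hcos : (2 : ℂ) * (cos θ : ℝ) * z = z ^ 2 + 1 := by
    rw [Complex.ofReal_cos, Complex.two_cos, hzi, ← hz]
    field_simp
  have hsin : (2 : ℂ) * (sin θ : ℝ) * z = (1 - z ^ 2) * Complex.I := by
    rw [Complex.ofReal_sin, Complex.two_sin, hzi, ← hz]
    field_simp
  by_contra! hle
  obtain h | h := eq_one_or_eq_neg_one_of_valuation_sub_one_le v h2 (n := 2 * n) (x := -z ^ 2)
    (by omega) (by rw [pow_mul, neg_sq, pow_right_comm, pow_right_comm z, hθ, one_pow, one_pow]) (by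
      have : -z ^ 2 - 1 = -(2 * (cos θ : ℝ) * z) := by rw [hcos]; ring
      rw [this, v.map_neg, map_mul, map_mul, v.map_eq_one_of_pow_eq_one hn hθ, mul_one]
      exact mul_le_of_le_one_right' hle)
  · refine hc ?_
    have : (2 : ℂ) * (cos θ : ℝ) * z = 0 := by rw [hcos, ← h]; ring
    simpa [hz0, -Complex.ofReal_cos] using this
  · refine hs ?_
    have : (2 : ℂ) * (sin θ : ℝ) * z = 0 := by rw [hsin, neg_injective h]; ring
    simpa [hz0, -Complex.ofReal_sin] using this

theorem valuation_sin_eq_valuation_cos (w : Valuation ℝ Γ₀) {θ : ℝ} (h : 1 < w (cos θ)) :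
    w (sin θ) = w (cos θ) := by
  have h1 : 1 < w (cos θ) ^ 2 := one_lt_pow₀ h two_ne_zero
  refine (pow_left_inj₀ zero_le zero_le two_ne_zero).1 ?_
  rw [← map_pow, sin_sq, w.map_sub_eq_of_lt_right, map_pow]
  rwa [map_one, map_pow]

end Valuation

/-! ### Alternating products in groups -/

/-- A ping-pong criterion: `P` and `Q` constrain the words that begin with a power of `T`, resp.
with a power of `S` different from `1`. -/
theorem injective_lift_of_alternating {G : Type*} [Group G] {S T : G} {P Q : Set G}
    (hQ : 1 ∈ Q) (hSQ : S⁻¹ ∈ Q) (hP : 1 ∉ P) (hSP : S⁻¹ ∉ P)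
    (hS : ∀ g ∈ P, S * g ∈ Q) (hS' : ∀ g ∈ P, S⁻¹ * g ∈ Q)
    (hT : ∀ g ∈ Q, T * g ∈ P) (hT' : ∀ g ∈ Q, T⁻¹ * g ∈ P)
    (hT2 : ∀ g ∈ Q, T ^ 2 * g ∈ P) (hT2' : ∀ g ∈ Q, (T ^ 2)⁻¹ * g ∈ P) :
    Function.Injective
      (FreeGroup.lift ![S * T * S * T, S * T ^ 2 * S * T ^ 2] : FreeGroup (Fin 2) →* G) := by
  -- Each letter is split as `pre * suf` so that all cancellation between neighbours `x`, `y` occurs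
  -- inside `suf x * pre y`, which always reduces to an alternating word from `S^{±1}` to a power of
  -- `T`.
  let pre : Fin 2 × Bool → G := fun x ↦
    ![bif x.2 then S * T else T⁻¹, bif x.2 then S * T ^ 2 else (T ^ 2)⁻¹] x.1
  let suf : Fin 2 × Bool → G := fun x ↦
    ![bif x.2 then S * T else S⁻¹ * T⁻¹ * S⁻¹,
      bif x.2 then S * T ^ 2 else S⁻¹ * (T ^ 2)⁻¹ * S⁻¹] x.1
  let φ : FreeGroup (Fin 2) →* G := FreeGroup.lift ![S * T * S * T, S * T ^ 2 * S * T ^ 2]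
  have hcons : ∀ (x : Fin 2 × Bool) L, φ (FreeGroup.mk (x :: L)) =
      pre x * (suf x * φ (FreeGroup.mk L)) := by
    rintro ⟨i, b⟩ L
    fin_cases i <;> cases b <;> simp [φ, pre, suf, mul_assoc]
  have key : ∀ (L : List (Fin 2 × Bool)) (x : Fin 2 × Bool), FreeGroup.IsReduced (x :: L) →
      suf x * φ (FreeGroup.mk L) ∈ Q := by
    intro L
    induction L with
    | nil =>
      rintro ⟨i, b⟩ -
      have h1 := hS' _ (hT' _ hSQ)
      have h2 : S * T ∈ Q := by simpa using hS _ (hT _ hQ)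
      have h3 := hS' _ (hT2' _ hSQ)
      have h4 : S * T ^ 2 ∈ Q := by simpa using hS _ (hT2 _ hQ)
      fin_cases i <;> cases b <;> simpa [suf, φ, mul_assoc] using by assumption
    | cons y L ih =>
      intro x hx
      rw [FreeGroup.IsReduced, List.isChain_cons_cons] at hx
      have hq := ih y hx.2
      have hxy := hx.1
      rw [hcons]
      generalize suf y * φ (FreeGroup.mk L) = q at hq
      obtain ⟨i, b⟩ := x
      obtain ⟨j, c⟩ := y
      have t := hT _ hq
      have t' := hT' _ hq
      have t2 := hT2 _ hq
      have t2' := hT2' _ hq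
      fin_cases i <;> fin_cases j <;> cases b <;> cases c <;> simp at hxy
      · convert hS' _ (hT' _ (hS' _ t')) using 1; simp [pre, suf, mul_assoc]
      · convert hS _ (hT _ (hS _ t)) using 1; simp [pre, suf, mul_assoc]
      · convert hS' _ (hT' _ (hS' _ t2')) using 1; simp [pre, suf, mul_assoc]
      · convert hS' _ t using 1; simp [pre, suf, mul_assoc, sq]
      · convert hS _ t' using 1; simp [pre, suf, mul_assoc, sq]
      · convert hS _ (hT _ (hS _ t2)) using 1; simp [pre, suf, mul_assoc]
      · convert hS' _ (hT2' _ (hS' _ t')) using 1; simp [pre, suf, mul_assoc]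
      · convert hS' _ t' using 1; simp [pre, suf, mul_assoc, sq]
      · convert hS _ t using 1; simp [pre, suf, mul_assoc, sq]
      · convert hS _ (hT2 _ (hS _ t)) using 1; simp [pre, suf, mul_assoc]
      · convert hS' _ (hT2' _ (hS' _ t2')) using 1; simp [pre, suf, mul_assoc]
      · convert hS _ (hT2 _ (hS _ t2)) using 1; simp [pre, suf, mul_assoc]
  rw [injective_iff_map_eq_one]
  intro a ha
  rw [← FreeGroup.toWord_eq_nil_iff]
  have hred := FreeGroup.isReduced_toWord (x := a)
  rw [← FreeGroup.mk_toWord (x := a)] at ha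
  cases hL : a.toWord with
  | nil => rfl
  | cons x L =>
    exfalso
    rw [hL] at ha hred
    have hq := key L x hred
    have hpq : pre x * (suf x * φ (FreeGroup.mk L)) = 1 := by rw [← hcons]; exact ha
    -- Applying the `T`-power of `pre x` to the tail puts `1` or `S⁻¹` in `P`.
    rw [eq_inv_of_mul_eq_one_right hpq] at hq
    obtain ⟨i, b⟩ := x
    fin_cases i <;> cases b
    · exact hP (by simpa [pre] using hT' _ hq)
    · exact hSP (by simpa [pre] using hT _ hq)
    · exact hP (by simpa [pre] using hT2' _ hq)
    · exact hSP (by simpa [pre] using hT2 _ hq)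

theorem FreeGroup.exists_basis_closure_pair {G : Type*} [Group G] {a b : G}
    (h : Function.Injective (FreeGroup.lift ![a, b] : FreeGroup (Fin 2) →* G)) :
    ∃ B : FreeGroupBasis (Fin 2) (Subgroup.closure {a, b} : Subgroup G),
      (B 0 : G) = a ∧ (B 1 : G) = b := by
  have hr : (FreeGroup.lift ![a, b] : FreeGroup (Fin 2) →* G).range = Subgroup.closure {a, b} := by
    rw [FreeGroup.range_lift_eq_closure, Matrix.range_cons_cons_empty]
  exact ⟨(FreeGroupBasis.ofFreeGroup (Fin 2)).map
    ((MonoidHom.ofInjective h).trans (MulEquiv.subgroupCongr hr)), by simp [MonoidHom.ofInjective_apply], by simp [MonoidHom.ofInjective_apply]⟩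

/-! ### Rotations -/

theorem rotX_mul_rotX (a b : ℝ) : rotX a * rotX b = rotX (a + b) := by
  ext i j
  fin_cases i <;> fin_cases j <;>
    simp [rotX, cos_add, sin_add] <;> ring

theorem rotX_zero : rotX 0 = 1 := by
  ext i j
  fin_cases i <;> fin_cases j <;> simp [rotX]

theorem inv_rotX (a : ℝ) : (rotX a)⁻¹ = rotX (-a) := by
  rw [inv_eq_iff_mul_eq_one, rotX_mul_rotX, add_neg_cancel, rotX_zero]

theorem rotX_sq (a : ℝ) : rotX a ^ 2 = rotX (2 * a) := by
  rw [sq, rotX_mul_rotX, two_mul]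

theorem inv_rotY (a : ℝ) : (rotY a)⁻¹ = rotY (-a) := by
  rw [inv_eq_iff_mul_eq_one]
  have h := sin_sq_add_cos_sq a
  ext i j
  fin_cases i <;> fin_cases j <;>
    simp [rotY] <;> linarith

section Columns

variable {Γ₀ : Type*} [LinearOrderedCommGroupWithZero Γ₀] (w : Valuation ℝ Γ₀)

/-- The rotations for which the image of the second basis vector has large second and third
coordinates. -/
def largeYZ : Set SO3 :=
  {g | w (g.1 2 1) = w (g.1 1 1) ∧ w (g.1 0 1) < w (g.1 1 1) ∧ 1 < w (g.1 1 1)}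

/-- The rotations for which the second coordinate of the image of the second basis vector dominates
the other two, the third one strictly. -/
def dominantY : Set SO3 :=
  {g | w (g.1 2 1) < w (g.1 1 1) ∧ w (g.1 0 1) ≤ w (g.1 1 1) ∧ 1 ≤ w (g.1 1 1)}

/-- As `sin θ` and `cos θ` have equal valuation, the strict inequality on the third coordinate
prevents cancellation in both new entries. -/
theorem rotX_mul_mem_largeYZ {θ : ℝ} (hθ : 1 < w (cos θ)) {g : SO3} (hg : g ∈ dominantY w) :
    rotX θ * g ∈ largeYZ w := by
  obtain ⟨hz, hx, hy⟩ := hg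
  have hs := valuation_sin_eq_valuation_cos w hθ
  have hc0 : 0 < w (cos θ) := zero_lt_one.trans hθ
  have hlt : w (cos θ) * w (g.1 2 1) < w (cos θ) * w (g.1 1 1) := by gcongr
  have e0 : (rotX θ * g).1 0 1 = g.1 0 1 := by
    simp [rotX, Matrix.mul_apply, Fin.sum_univ_three]
  have e1 : (rotX θ * g).1 1 1 = cos θ * g.1 1 1 - sin θ * g.1 2 1 := by
    simp [rotX, Matrix.mul_apply, Fin.sum_univ_three]; ring
  have e2 : (rotX θ * g).1 2 1 = sin θ * g.1 1 1 + cos θ * g.1 2 1 := by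
    simp [rotX, Matrix.mul_apply, Fin.sum_univ_three]
  have v1 : w ((rotX θ * g).1 1 1) = w (cos θ) * w (g.1 1 1) := by
    rw [e1, w.map_sub_eq_of_lt_left, map_mul]
    rwa [map_mul, map_mul, hs]
  have v2 : w ((rotX θ * g).1 2 1) = w (cos θ) * w (g.1 1 1) := by
    rw [e2, w.map_add_eq_of_lt_left, map_mul, hs]
    rwa [map_mul, map_mul, hs]
  have hlt' : w (g.1 1 1) < w (cos θ) * w (g.1 1 1) :=
    lt_mul_of_one_lt_left (zero_lt_one.trans_le hy) hθ
  refine ⟨v2.trans v1.symm, ?_, ?_⟩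
  · rw [v1, e0]; exact hx.trans_lt hlt'
  · rw [v1]; exact hy.trans_lt hlt'

theorem rotY_pi_div_two_mul_mem_dominantY {g : SO3} (hg : g ∈ largeYZ w) :
    rotY (π / 2) * g ∈ dominantY w := by
  obtain ⟨hz, hx, hy⟩ := hg
  simp [dominantY, rotY, Matrix.mul_apply, Fin.sum_univ_three, hz, hx, hy.le]

theorem inv_rotY_pi_div_two_mul_mem_dominantY {g : SO3} (hg : g ∈ largeYZ w) :
    (rotY (π / 2))⁻¹ * g ∈ dominantY w := by
  obtain ⟨hz, hx, hy⟩ := hg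
  rw [inv_rotY]
  simp [dominantY, rotY, Matrix.mul_apply, Fin.sum_univ_three, hz, hx, hy.le]

theorem injective_lift_of_one_lt_valuation_cos {θ : ℝ} (h1 : 1 < w (cos θ))
    (h2 : 1 < w (cos (2 * θ))) :
    Function.Injective (FreeGroup.lift
      ![rotY (π / 2) * rotX θ * rotY (π / 2) * rotX θ,
        rotY (π / 2) * rotX θ ^ 2 * rotY (π / 2) * rotX θ ^ 2] : FreeGroup (Fin 2) →* SO3) := by
  refine injective_lift_of_alternating (P := largeYZ w) (Q := dominantY w) ?_ ?_ ?_ ?_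
    (fun g ↦ rotY_pi_div_two_mul_mem_dominantY w) (fun g ↦ inv_rotY_pi_div_two_mul_mem_dominantY w)
    (fun g ↦ rotX_mul_mem_largeYZ w h1) (fun g ↦ ?_) (fun g ↦ ?_) (fun g ↦ ?_)
  · simp [dominantY]
  · rw [inv_rotY]; simp [dominantY, rotY]
  · simp [largeYZ]
  · rw [inv_rotY]; simp [largeYZ, rotY]
  · rw [inv_rotX]; exact rotX_mul_mem_largeYZ w (by rwa [cos_neg])
  · rw [rotX_sq]; exact rotX_mul_mem_largeYZ w h2
  · rw [rotX_sq, inv_rotX]; exact rotX_mul_mem_largeYZ w (by rwa [cos_neg])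

end Columns

theorem sin_eight_pi_div_ne_zero {m : ℕ} (hm : 0 < m) (h1 : m ≠ 1) (h2 : m ≠ 2) (h4 : m ≠ 4)
    (h8 : m ≠ 8) : sin (8 * π / m) ≠ 0 := by
  rw [Ne, sin_eq_zero_iff]
  rintro ⟨k, hk⟩
  have hm' : (m : ℝ) ≠ 0 := by positivity
  have hk' : (k : ℝ) * m = 8 := by
    field_simp at hk
    linarith
  have hdvd : (m : ℤ) ∣ 8 := ⟨k, by rw [mul_comm]; exact_mod_cast hk'.symm⟩
  have hdvd' : m ∣ 8 := by exact_mod_cast hdvd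
  have hle := Nat.le_of_dvd (by norm_num) hdvd'
  interval_cases m <;> omega

theorem exp_two_pi_div_mul_I_pow {m : ℕ} (hm : m ≠ 0) :
    Complex.exp ((2 * π / m : ℝ) * Complex.I) ^ m = 1 := by
  have hm' : (m : ℂ) ≠ 0 := by exact_mod_cast hm
  rw [← Complex.exp_nat_mul, ← Complex.exp_two_pi_mul_I]
  congr 1
  push_cast
  field_simp

theorem mainTheorem6 (m : ℕ) (hm : 0 < m) (h1 : m ≠ 1) (h2 : m ≠ 2) (h4 : m ≠ 4) (h8 : m ≠ 8)
    (S T A B : SO3) (hS : S = rotY (π / 2)) (hT : T = rotX (2 * π / m))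
    (hA : A = S * T * S * T) (hB : B = S * T ^ 2 * S * T ^ 2) :
    Function.Injective (FreeGroup.lift ![A, B] : FreeGroup (Fin 2) →* SO3) ∧
      (∃ b : FreeGroupBasis (Fin 2) (Subgroup.closure {A, B} : Subgroup SO3),
        (b 0 : SO3) = A ∧ (b 1 : SO3) = B) ∧
      Subgroup.closure {A, B} ≤ hatG m 4 := by
  have hinj : Function.Injective (FreeGroup.lift ![A, B] : FreeGroup (Fin 2) →* SO3) := by
    obtain ⟨V, hV⟩ := exists_valuationSubring_valuation_two_lt_one
    have hs8 := sin_eight_pi_div_ne_zero hm h1 h2 h4 h8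
    set θ : ℝ := 2 * π / m with hθ
    -- Since `sin 4θ = 4 sin θ cos θ cos 2θ`, its nonvanishing supplies every sine and cosine
    -- condition needed at `θ` and `2θ`.
    have e : 8 * π / m = 2 * (2 * θ) := by rw [hθ]; ring
    rw [e, sin_two_mul] at hs8
    have hc2 : cos (2 * θ) ≠ 0 := right_ne_zero_of_mul hs8
    have hs2 : sin (2 * θ) ≠ 0 := right_ne_zero_of_mul (left_ne_zero_of_mul hs8)
    have hs2' := hs2
    rw [sin_two_mul] at hs2'
    have hexp := exp_two_pi_div_mul_I_pow hm.ne'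
    rw [← hθ] at hexp
    have hexp2 : Complex.exp ((2 * θ : ℝ) * Complex.I) ^ m = 1 := by
      have : ((2 * θ : ℝ) : ℂ) * Complex.I = (2 : ℕ) * (θ * Complex.I) := by push_cast; ring
      rw [this, Complex.exp_nat_mul, pow_right_comm, hexp, one_pow]
    rw [hA, hB, hS, hT]
    exact injective_lift_of_one_lt_valuation_cos (V.valuation.comap Complex.ofRealHom)
      (one_lt_valuation_cos _ hV hm.ne' hexp (right_ne_zero_of_mul (left_ne_zero_of_mul hs2'))
        (right_ne_zero_of_mul hs2'))
      (one_lt_valuation_cos _ hV hm.ne' hexp2 hs2 hc2)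
  refine ⟨hinj, FreeGroup.exists_basis_closure_pair hinj, ?_⟩
  have hSG : S ∈ hatG m 4 := Subgroup.subset_closure (by
    right
    rw [Set.mem_singleton_iff, hS]
    congr 1
    push_cast
    ring)
  have hTG : T ∈ hatG m 4 := Subgroup.subset_closure (Or.inl hT)
  rw [Subgroup.closure_le]
  rintro _ (rfl | rfl)
  · rw [hA]
    exact mul_mem (mul_mem (mul_mem hSG hTG) hSG) hTG
  · rw [hB]
    exact mul_mem (mul_mem (mul_mem hSG (pow_mem hTG 2)) hSG) (pow_mem hTG 2)
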